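/- A (finite) hypergraph $H$ has a finite vertex set $V(H)$ and an edge set $E(H)\subseteq 2^{V(H)}$. It is odd (resp. even) if $|V(H)|$ is odd (resp. even); $3$-uniform if every edge has exactly three vertices; linear if any two distinct edges share at most one vertex; connected if for all distinct $a,b\in V(H)$ there is a sequence of edges $(e_1,\dots,e_\ell)$ with $a\in e_1$, $b\in e_\ell$ and $e_i\cap e_{i+1}\neq\varnothing$ for all $1\le i\le \ell-1$. The degree of a vertex is the number of edges containing it; a leaf-edge is an edge with at most one vertex of degree greater than $1$; $H$ is reduced if it has no leaf-edge of size $3$. An isolated vertex is a hypergraph with exactly one vertex and no edge. Linear trees are defined recursively: an isolated vertex is a linear tree, and so is any hypergraph obtained from a linear tree $T$ by adding an edge (together with its new vertices) that shares exactly one vertex with $T$. In the Avoider-Enforcer game on $H$, the two players Avoider and Enforcer alternately pick a not yet picked vertex of $H$ until all vertices have been picked. Enforcer wins if Avoider has picked all the vertices of some edge; otherwise Avoider wins. Avoider wins on $H$ as last player if she has a winning strategy when she plays the last move, i.e. when she is the first player if $H$ is odd and the second player if $H$ is even. **Corollary.** Let $H$ be an odd connected linear $3$-uniform hypergraph. Then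 Avoider wins on $H$ as last player if and only if $H$ is a linear tree. If moreover $H$ is reduced, then Avoider wins on $H$ as last player if and only if $H$ is an isolated vertex. -/

import Mathlib

namespace Hypergraph

open Set

/-- Any two distinct edges share at most one vertex. -/
def IsLinear {α : Type*} (H : Hypergraph α) : Prop :=
  ∀ e ∈ H.edgeSet, ∀ f ∈ H.edgeSet, e ≠ f → (e ∩ f).encard ≤ 1

/-- Every edge has exactly `k` vertices. -/
def IsUniform {α : Type*} (H : Hypergraph α) (k : ℕ) : Prop :=
  ∀ e ∈ H.edgeSet, e.encard = k

/-- A walk: a sequence of edges in which any two consecutive edges intersect. -/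
def IsWalk {α : Type*} (H : Hypergraph α) (w : List (Set α)) : Prop :=
  (∀ e ∈ w, e ∈ H.edgeSet) ∧ w.IsChain (fun e f => (e ∩ f).Nonempty)

/-- Any two distinct vertices `a`, `b` are joined by a walk whose first edge contains `a` and whose
last edge contains `b`. -/
def IsConnected {α : Type*} (H : Hypergraph α) : Prop :=
  ∀ a ∈ H.vertexSet, ∀ b ∈ H.vertexSet, a ≠ b →
    ∃ w : List (Set α), H.IsWalk w ∧ (∃ e ∈ w.head?, a ∈ e) ∧ (∃ f ∈ w.getLast?, b ∈ f)

/-- The number of edges containing `x`. -/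
noncomputable def degree {α : Type*} (H : Hypergraph α) (x : α) : ℕ∞ :=
  {e ∈ H.edgeSet | x ∈ e}.encard

/-- A leaf-edge: an edge with at most one vertex of degree greater than 1. -/
def IsLeafEdge {α : Type*} (H : Hypergraph α) (e : Set α) : Prop :=
  e ∈ H.edgeSet ∧ {x ∈ e | 1 < H.degree x}.encard ≤ 1

/-- A hypergraph (of rank 3) is reduced if it has no leaf-edge of size 3. -/
def IsReduced {α : Type*} (H : Hypergraph α) : Prop :=
  ∀ e, H.IsLeafEdge e → e.encard ≠ 3

/-- The hypergraph consists of exactly one vertex and has no edge. -/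
def IsIsolatedVertex {α : Type*} (H : Hypergraph α) : Prop :=
  (∃ v, H.vertexSet = {v}) ∧ H.edgeSet = ∅

/-- Linear trees: an isolated vertex is a linear tree, and adding to a linear tree `T` an edge `e`
(together with its new vertices) sharing exactly one vertex with `T` gives a linear tree. -/
inductive IsLinearTree {α : Type*} : Hypergraph α → Prop
  | isolatedVertex (H : Hypergraph α) (hH : H.IsIsolatedVertex) : IsLinearTree H
  | addEdge (T H : Hypergraph α) (e : Set α) (hT : IsLinearTree T)
      (he : (e ∩ T.vertexSet).encard = 1)
      (hV : H.vertexSet = T.vertexSet ∪ e) (hE : H.edgeSet = insert e T.edgeSet) :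
      IsLinearTree H

/-- The two players of the Avoider-Enforcer game. -/
inductive Player
  | avoider
  | enforcer

/-- `H.AvoiderWinsFrom p A U`: Avoider can force a win in the game on `H` from the position in which
`A` is the set of vertices already picked by Avoider, `U` is the set of vertices not yet picked by
anybody, and player `p` is to move. The game ends when all vertices have been picked, and Avoider
has then won if she has picked all the vertices of no edge. -/
inductive AvoiderWinsFrom {α : Type*} (H : Hypergraph α) : Player → Set α → Set α → Prop
  /-- The game is over and Avoider has not filled an edge. -/
  | gameOver (p : Player) (A : Set α) (hA : ∀ e ∈ H.edgeSet, ¬ e ⊆ A) : AvoiderWinsFrom H p A ∅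
  /-- Avoider is to move: some pick is winning. -/
  | avoiderMove (A U : Set α) (x : α) (hx : x ∈ U)
      (h : AvoiderWinsFrom H Player.enforcer (insert x A) (U \ {x})) :
      AvoiderWinsFrom H Player.avoider A U
  /-- Enforcer is to move: Avoider wins after each possible pick. -/
  | enforcerMove (A U : Set α) (hU : U.Nonempty)
      (h : ∀ y ∈ U, AvoiderWinsFrom H Player.avoider A (U \ {y})) :
      AvoiderWinsFrom H Player.enforcer A U

/-- Avoider has a winning strategy as first player. -/
def AvoiderWinsAsFirst {α : Type*} (H : Hypergraph α) : Prop :=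
  H.AvoiderWinsFrom Player.avoider ∅ H.vertexSet

/-- Avoider has a winning strategy as second player. -/
def AvoiderWinsAsSecond {α : Type*} (H : Hypergraph α) : Prop :=
  H.AvoiderWinsFrom Player.enforcer ∅ H.vertexSet

/-- Avoider has a winning strategy as last player (on a finite hypergraph): the last player is the
first player if the number of vertices is odd, and the second player if it is even. -/
def AvoiderWinsAsLast {α : Type*} (H : Hypergraph α) : Prop :=
  (Odd H.vertexSet.ncard → H.AvoiderWinsAsFirst) ∧
    (Even H.vertexSet.ncard → H.AvoiderWinsAsSecond)

end Hypergraph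

namespace Hypergraph

open Set

variable {α : Type*} {H : Hypergraph α}

/-! ### Connectedness by cuts -/

/-! Both directions rest on parity. In a `3`-uniform linear tree each added edge brings two new
vertices. Avoider takes the root, then answers each pick inside its pair, so she never owns both
halves of a pair (`exists_pairing`). For the converse, call a connected odd set of free vertices
with an edge already touched by Avoider a trap. With an even number of free vertices, Enforcer can
always move outside a trap, while any move of Avoider inside it fills an edge or leaves a smaller
trap (`IsTrap.step`). Traps are nonempty, so play cannot end without a filled edge. If the
hypergraph is not a linear tree, any first pick `v` lies in a connected even set
(`exists_even_connectedOn`), and deleting `v` leaves an odd component, which is a trap. -/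

/-- Every cut of `X` is crossed by an edge contained in `A ∪ X`: the traces on `X` of these edges
form a connected hypergraph. -/
def ConnectedOn (H : Hypergraph α) (A X : Set α) : Prop :=
  ∀ W ⊆ X, W.Nonempty → (X \ W).Nonempty →
    ∃ e ∈ H.edgeSet, e ⊆ A ∪ X ∧ (e ∩ W).Nonempty ∧ (e ∩ (X \ W)).Nonempty

lemma ConnectedOn.mono {A B X : Set α} (h : H.ConnectedOn A X) (hAB : A ⊆ B) :
    H.ConnectedOn B X := by
  intro W hW h₁ h₂
  obtain ⟨e, he, hs, hn⟩ := h W hW h₁ h₂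
  exact ⟨e, he, hs.trans (union_subset_union_left _ hAB), hn⟩

lemma connectedOn_singleton (A : Set α) (v : α) : H.ConnectedOn A {v} := by
  intro W hW h₁ h₂
  obtain rfl := h₁.subset_singleton_iff.1 hW
  simp at h₂

/-- Adding to a connected set the trace of an edge that meets it keeps it connected. -/
lemma ConnectedOn.union_edge {A Y e : Set α} (h : H.ConnectedOn A Y) (he : e ∈ H.edgeSet)
    (hY : (e ∩ Y).Nonempty) : H.ConnectedOn A (Y ∪ (e \ A)) := by
  intro W hW h₁ h₂
  by_cases hWY : (W ∩ Y).Nonempty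
  · by_cases hYW : (Y \ W).Nonempty
    · obtain ⟨f, hf, hs, ⟨a, ha, haW⟩, ⟨b, hb, hbW⟩⟩ :=
        h (W ∩ Y) inter_subset_right hWY (by rwa [sdiff_inter_self_eq_sdiff])
      exact ⟨f, hf, by grind, ⟨a, by grind⟩, ⟨b, by grind⟩⟩
    · rw [not_nonempty_iff_eq_empty, sdiff_eq_empty] at hYW
      obtain ⟨a, ha⟩ := hY
      obtain ⟨b, hb⟩ := h₂
      exact ⟨e, he, by grind, ⟨a, by grind⟩, ⟨b, by grind⟩⟩
  · rw [not_nonempty_iff_eq_empty] at hWY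
    obtain ⟨a, ha⟩ := hY
    obtain ⟨b, hb⟩ := h₁
    have haW : a ∉ W := fun h' => (hWY ▸ ⟨h', ha.2⟩ : a ∈ (∅ : Set α))
    have hbY : b ∉ Y := fun h' => (hWY ▸ ⟨hb, h'⟩ : b ∈ (∅ : Set α))
    exact ⟨e, he, by grind, ⟨b, by grind⟩, ⟨a, by grind⟩⟩

lemma exists_crossing_edge_of_isWalk {W : Set α} :
    ∀ (w : List (Set α)) (a b : α), H.IsWalk w → (∃ e ∈ w.head?, a ∈ e) →
      (∃ f ∈ w.getLast?, b ∈ f) → a ∈ W → b ∉ W →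
      ∃ e ∈ H.edgeSet, (e ∩ W).Nonempty ∧ (e \ W).Nonempty := by
  intro w
  induction w with
  | nil => simp
  | cons e w ih =>
    rintro a b hw ⟨_, he, hae⟩ hb haW hbW
    obtain rfl : e = _ := by simpa using he
    have heE : e ∈ H.edgeSet := hw.1 e (by simp)
    by_cases heW : (e \ W).Nonempty
    · exact ⟨e, heE, ⟨a, hae, haW⟩, heW⟩
    rw [not_nonempty_iff_eq_empty, sdiff_eq_empty] at heW
    cases w with
    | nil =>
      obtain ⟨f, hf, hbf⟩ := hb
      obtain rfl : e = f := by simpa using hf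
      exact absurd (heW hbf) hbW
    | cons f w =>
      obtain ⟨hef, hch⟩ := List.isChain_cons_cons.1 hw.2
      obtain ⟨c, hce, hcf⟩ := hef
      exact ih c b ⟨fun g hg => hw.1 g (by simp [hg]), hch⟩ ⟨f, by simp, hcf⟩
        (by simpa [List.getLast?_cons_cons] using hb) (heW hce) hbW

lemma IsConnected.connectedOn (h : H.IsConnected) : H.ConnectedOn ∅ H.vertexSet := by
  rintro W hW ⟨a, ha⟩ ⟨b, hb, hbW⟩
  obtain ⟨w, hw, h₁, h₂⟩ := h a (hW ha) b hb (by rintro rfl; exact hbW ha)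
  obtain ⟨e, he, h₃, ⟨c, hc, hcW⟩⟩ := exists_crossing_edge_of_isWalk w a b hw h₁ h₂ ha hbW
  have hs := H.subset_vertexSet_of_mem_edgeSet' he
  exact ⟨e, he, by simpa using hs, h₃, ⟨c, hc, hs hc, hcW⟩⟩

/-! ### Parity arguments -/

/-- Removing a vertex `v` from a connected set of even size leaves a connected component of odd
size, which contains the remainder of an edge through `v`. -/
lemma ConnectedOn.exists_odd_part {A Y : Set α} {v : α} (hY : H.ConnectedOn A Y) (hfin : Y.Finite)
    (hA : Disjoint A Y) (hv : v ∈ Y) (heven : Even Y.ncard) :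
    ∃ Z ⊆ Y \ {v}, Odd Z.ncard ∧ H.ConnectedOn (insert v A) Z ∧
      ∃ e ∈ H.edgeSet, e ⊆ insert v A ∪ Z ∧ v ∈ e := by
  have hcard := ncard_sdiff_singleton_add_one hv hfin
  -- Odd unions of components of `Y \ {v}`. If a minimal one split into two parts with no edge
  -- across, one part would be odd and still closed.
  let S : Set (Set α) := {Z | Z ⊆ Y \ {v} ∧ Odd Z.ncard ∧
    ∀ e ∈ H.edgeSet, e ⊆ A ∪ Y → (e ∩ Z).Nonempty → e ⊆ insert v A ∪ Z}
  have hSfin : S.Finite := hfin.finite_subsets.subset fun Z hZ => hZ.1.trans sdiff_subset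
  have hSne : S.Nonempty := by
    refine ⟨Y \ {v}, Subset.rfl, ?_, fun e _ he _ => by grind⟩
    rw [← hcard, Nat.even_add_one] at heven
    exact Nat.not_even_iff_odd.1 heven
  obtain ⟨Z, ⟨hZY, hZodd, hZcl⟩, hmin⟩ := hSfin.exists_minimal hSne
  have hZfin : Z.Finite := hfin.subset (hZY.trans sdiff_subset)
  refine ⟨Z, hZY, hZodd, ?_, ?_⟩
  · intro W hWZ hW₁ hW₂
    by_contra hno
    push Not at hno
    have hcl₁ : ∀ e ∈ H.edgeSet, e ⊆ A ∪ Y → (e ∩ W).Nonempty → e ⊆ insert v A ∪ W := by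
      intro e he heY heW
      have h₁ := hZcl e he heY (heW.mono (by grind))
      have h₂ := hno e he h₁ heW
      intro x hx
      by_contra hxn
      exact (h₂ ▸ (by grind : x ∈ e ∩ (Z \ W)) : x ∈ (∅ : Set α))
    have hcl₂ : ∀ e ∈ H.edgeSet, e ⊆ A ∪ Y → (e ∩ (Z \ W)).Nonempty →
        e ⊆ insert v A ∪ (Z \ W) := by
      intro e he heY heW
      have h₁ := hZcl e he heY (heW.mono (by grind))
      intro x hx
      by_contra hxn
      exact heW.ne_empty (hno e he h₁ ⟨x, by grind⟩)
    have hsum := ncard_sdiff_add_ncard_of_subset hWZ hZfin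
    rcases Nat.even_or_odd W.ncard with hev | hod
    · have hlt := hmin (y := Z \ W) ⟨by grind, by grind, hcl₂⟩ sdiff_subset
      obtain ⟨x, hx⟩ := hW₁
      exact (hlt (hWZ hx)).2 hx
    · have hlt := hmin (y := W) ⟨by grind, hod, hcl₁⟩ hWZ
      obtain ⟨x, hx⟩ := hW₂
      exact hx.2 (hlt hx.1)
  · have hZne : Z.Nonempty := nonempty_of_ncard_ne_zero (by grind)
    obtain ⟨e, he, heY, h₁, ⟨b, hbe, hbY, hbZ⟩⟩ :=
      hY Z (hZY.trans sdiff_subset) hZne ⟨v, hv, fun h => (hZY h).2 rfl⟩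
    have hsub := hZcl e he heY h₁
    -- Closedness of `Z` forces any edge crossing out of it within `Y` to pass through `v`.
    by_cases hve : v ∈ e
    · exact ⟨e, he, hsub, hve⟩
    have hbA : b ∉ A := fun h => disjoint_left.1 hA h hbY
    grind

/-- A connected set of odd size, all of whose vertices are still free, one of whose edges has
already been touched by Avoider. -/
def IsTrap (H : Hypergraph α) (A X : Set α) : Prop :=
  Odd X.ncard ∧ Disjoint A X ∧ H.ConnectedOn A X ∧
    ∃ e ∈ H.edgeSet, e ⊆ A ∪ X ∧ (e ∩ A).Nonempty

lemma ConnectedOn.exists_isTrap {A Y : Set α} {v : α} (hY : H.ConnectedOn A Y) (hfin : Y.Finite)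
    (hA : Disjoint A Y) (hv : v ∈ Y) (heven : Even Y.ncard) :
    ∃ Z ⊆ Y \ {v}, H.IsTrap (insert v A) Z := by
  obtain ⟨Z, hZY, hodd, hconn, e, he, heZ, hve⟩ := hY.exists_odd_part hfin hA hv heven
  refine ⟨Z, hZY, hodd, ?_, hconn, e, he, heZ, v, hve, mem_insert _ _⟩
  rw [disjoint_left] at hA ⊢
  grind

lemma isTrap_singleton {A e : Set α} {y : α} (he : e ∈ H.edgeSet) (hy : y ∉ A)
    (hs : e ⊆ insert y A) (hn : (e ∩ A).Nonempty) : H.IsTrap A {y} :=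
  ⟨by simp, by simpa using hy, connectedOn_singleton A y, e, he, by grind, hn⟩

lemma IsUniform.finite_of_mem {k : ℕ} {e : Set α} (hunif : H.IsUniform k) (he : e ∈ H.edgeSet) :
    e.Finite :=
  finite_of_encard_eq_coe (hunif e he)

lemma IsUniform.ncard_eq {k : ℕ} {e : Set α} (hunif : H.IsUniform k) (he : e ∈ H.edgeSet) :
    e.ncard = k := by
  rw [ncard_def, hunif e he, ENat.toNat_natCast]

lemma IsLinear.eq_of_mem (hlin : H.IsLinear) {e f : Set α} (he : e ∈ H.edgeSet)
    (hf : f ∈ H.edgeSet) (hef : e ≠ f) {a b : α} (ha : a ∈ e) (ha' : a ∈ f) (hb : b ∈ e)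
    (hb' : b ∈ f) : a = b :=
  encard_le_one_iff.1 (hlin e he f hf hef) a b ⟨ha, ha'⟩ ⟨hb, hb'⟩

/-- After any move of Avoider inside a trap, either she has filled an edge or a smaller trap
remains. -/
lemma IsTrap.step (hlin : H.IsLinear) (hunif : H.IsUniform 3) {A X : Set α} {v : α}
    (hX : H.IsTrap A X) (hfin : X.Finite) (hv : v ∈ X) :
    (∃ e ∈ H.edgeSet, e ⊆ insert v A) ∨ ∃ Z ⊆ X \ {v}, H.IsTrap (insert v A) Z := by
  obtain ⟨-, hA, hconn, e₀, he₀, he₀X, hn⟩ := hX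
  by_cases hfill : ∃ e ∈ H.edgeSet, e ⊆ insert v A
  · exact .inl hfill
  push Not at hfill
  right
  have hdis := disjoint_left.1 hA
  have he₀f := hunif.finite_of_mem he₀
  have hY₀ : ∃ y ∈ e₀, y ∉ insert v A := by
    by_contra h
    push Not at h
    exact hfill e₀ he₀ h
  obtain ⟨y, hye, hyA⟩ := hY₀
  have hyX : y ∈ X := by grind
  by_cases hsing : e₀ ⊆ insert y (insert v A)
  · exact ⟨{y}, by grind, isTrap_singleton he₀ hyA hsing (hn.mono (by grind))⟩
  -- What remains is the case where `e₀` has one vertex in `A` and two free ones, both different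
  -- from `v`.
  suffices ∃ Y ⊆ X, v ∈ Y ∧ H.ConnectedOn A Y ∧ Even Y.ncard by
    obtain ⟨Y, hYX, hvY, hY, hev⟩ := this
    obtain ⟨Z, hZ, hZt⟩ := hY.exists_isTrap (hfin.subset hYX) (hA.mono_right hYX) hvY hev
    exact ⟨Z, hZ.trans (sdiff_subset_sdiff_left hYX), hZt⟩
  have hcard₀ : (e₀ \ A).ncard = 2 := by
    have h₁ := hunif.ncard_eq he₀
    have h₂ := ncard_inter_add_ncard_sdiff_eq_ncard e₀ A he₀f
    have h₃ : 0 < (e₀ ∩ A).ncard := (ncard_pos (he₀f.subset inter_subset_left)).2 hn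
    rw [not_subset] at hsing
    obtain ⟨z, hz, hzA⟩ := hsing
    have h₄ : 1 < (e₀ \ A).ncard :=
      (one_lt_ncard_iff (he₀f.subset sdiff_subset)).2 ⟨y, z, by grind, by grind, by grind⟩
    omega
  have hve₀ : v ∉ e₀ := by
    intro hve
    have hlt : 2 < (e₀ \ A).ncard := by
      obtain ⟨z, hz, hzA⟩ := not_subset.1 hsing
      exact (two_lt_ncard_iff (he₀f.subset sdiff_subset)).2
        ⟨v, y, z, by grind, by grind, by grind, by grind, by grind, by grind⟩
    omega
  -- Grow a connected set from `v` until one more edge `e` reaches `e₀`. By linearity the enlarged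
  -- set meets `e₀ \ A` in one vertex, so adding `e₀` contributes one more and flips the parity.
  let S : Set (Set α) := {Y | Y ⊆ X ∧ v ∈ Y ∧ H.ConnectedOn A Y ∧ Disjoint Y e₀}
  have hSfin : S.Finite := hfin.finite_subsets.subset fun Y hY => hY.1
  obtain ⟨Y, ⟨hYX, hvY, hYc, hYe⟩, hmax⟩ := hSfin.exists_maximal
    ⟨{v}, by simpa using hv, rfl, connectedOn_singleton A v, by simpa using hve₀⟩
  obtain ⟨e, he, heX, hey, ⟨b, hbe, hbX, hbY⟩⟩ :=
    hconn Y hYX ⟨v, hvY⟩ ⟨y, hyX, fun h => disjoint_left.1 hYe h hye⟩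
  have hbA : b ∉ A := fun h => hdis h hbX
  have hY'c := hYc.union_edge he hey
  have hY'X : Y ∪ (e \ A) ⊆ X := by grind
  have hmeet : ¬ Disjoint (Y ∪ (e \ A)) e₀ := fun h =>
    hbY (hmax (y := Y ∪ (e \ A)) ⟨hY'X, .inl hvY, hY'c, h⟩ subset_union_left (.inr ⟨hbe, hbA⟩))
  rcases Nat.even_or_odd (Y ∪ (e \ A)).ncard with hev | hod
  · exact ⟨_, hY'X, .inl hvY, hY'c, hev⟩
  have hne : e ≠ e₀ := by
    rintro rfl
    obtain ⟨x, hx, hxY⟩ := hey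
    exact disjoint_left.1 hYe hxY hx
  obtain ⟨c, hc, hce⟩ := not_disjoint_iff.1 hmeet
  have hint : (Y ∪ (e \ A)) ∩ (e₀ \ A) = {c} := by
    have hYe' := disjoint_left.1 hYe
    ext d
    constructor
    · rintro ⟨hd, hde, -⟩
      exact hlin.eq_of_mem he he₀ hne (by grind) (by grind) (by grind) (by grind)
    · rintro rfl
      exact ⟨hc, hce, fun h => hdis h (hY'X hc)⟩
  refine ⟨_, union_subset hY'X (by grind : e₀ \ A ⊆ X), .inl (.inl hvY),
    hY'c.union_edge he₀ ⟨c, hce, hc⟩, ?_⟩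
  have hsum := ncard_union_add_ncard_inter (Y ∪ (e \ A)) (e₀ \ A) (hfin.subset hY'X)
    (he₀f.subset sdiff_subset)
  rw [hint, ncard_singleton, hcard₀] at hsum
  grind

/-! ### Enforcer's strategy -/

lemma not_avoiderWinsFrom_of_subset {A U e : Set α} {p : Player} (he : e ∈ H.edgeSet)
    (heA : e ⊆ A) : ¬ H.AvoiderWinsFrom p A U := by
  intro h
  induction h with
  | gameOver p A hA => exact hA e he heA
  | avoiderMove A U x hx h ih => exact ih (heA.trans (subset_insert _ _))
  | enforcerMove A U hU h ih =>
    obtain ⟨y, hy⟩ := hU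
    exact ih y hy heA

/-- Enforcer, to move on an even number of free vertices, wins if there is a trap. -/
lemma IsTrap.not_avoiderWinsFrom_enforcer {A U Z : Set α}
    (ih : ∀ U', U' ⊆ U → U'.ncard + 1 = U.ncard → Z ⊆ U' → ¬ H.AvoiderWinsFrom .avoider A U')
    (hfin : U.Finite) (heven : Even U.ncard) (hZU : Z ⊆ U) (hZ : H.IsTrap A Z) :
    ¬ H.AvoiderWinsFrom .enforcer A U := by
  intro h
  have hne : (U \ Z).Nonempty := by
    by_contra h'
    rw [not_nonempty_iff_eq_empty, sdiff_eq_empty] at h'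
    rw [h'.antisymm hZU, ← Nat.not_odd_iff_even] at heven
    exact heven hZ.1
  obtain ⟨y, hyU, hyZ⟩ := hne
  cases h with
  | gameOver => exact hyU
  | enforcerMove _ _ hU h =>
    exact ih _ sdiff_subset (ncard_sdiff_singleton_add_one hyU hfin) (by grind) (h y hyU)

/-- Enforcer wins when Avoider is to move on an odd number of free vertices and there is a trap. -/
lemma IsTrap.not_avoiderWinsFrom_avoider (hlin : H.IsLinear) (hunif : H.IsUniform 3) {n : ℕ}
    {A U X : Set α} (hfin : U.Finite) (hcard : U.ncard = 2 * n + 1) (hXU : X ⊆ U)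
    (hX : H.IsTrap A X) : ¬ H.AvoiderWinsFrom .avoider A U := by
  induction n using Nat.strong_induction_on generalizing A U X with
  | _ n ih =>
  intro h
  cases h with
  | gameOver => simp at hcard
  | avoiderMove _ _ v hv h =>
    have hcard' := ncard_sdiff_singleton_add_one hv hfin
    have key : (∃ e ∈ H.edgeSet, e ⊆ insert v A) ∨
        ∃ Z ⊆ U \ {v}, H.IsTrap (insert v A) Z := by
      by_cases hvX : v ∈ X
      · exact (hX.step hlin hunif (hfin.subset hXU) hvX).imp_right
          fun ⟨Z, hZ, hZt⟩ => ⟨Z, hZ.trans (sdiff_subset_sdiff_left hXU), hZt⟩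
      · obtain ⟨hodd, hA, hconn, e, he, heX, hn⟩ := hX
        exact .inr ⟨X, by grind, hodd, disjoint_insert_left.2 ⟨hvX, hA⟩,
          hconn.mono (subset_insert _ _), e, he, by grind, hn.mono (by grind)⟩
    obtain ⟨e, he, heA⟩ | ⟨Z, hZU, hZ⟩ := key
    · exact not_avoiderWinsFrom_of_subset he heA h
    · refine hZ.not_avoiderWinsFrom_enforcer (fun U' hU' hc hZU' => ?_)
        (hfin.subset sdiff_subset) ⟨n, by omega⟩ hZU h
      exact ih (n - 1) (by omega) (hfin.subset (hU'.trans sdiff_subset)) (by omega) hZU' hZ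

/-! ### Linear trees -/

/-- In a connected linear `3`-uniform hypergraph that is not a linear tree, every vertex lies in a
connected set of even size. -/
lemma exists_even_connectedOn (hfin : H.vertexSet.Finite) (hconn : H.IsConnected)
    (hlin : H.IsLinear) (hunif : H.IsUniform 3) (htree : ¬ H.IsLinearTree) {v : α}
    (hv : v ∈ H.vertexSet) :
    ∃ Y ⊆ H.vertexSet, v ∈ Y ∧ H.ConnectedOn ∅ Y ∧ Even Y.ncard := by
  by_contra! hno
  -- Subtrees containing `v` that every other edge meets in at most one vertex.
  let S : Set (Set α) := {Y | Y ⊆ H.vertexSet ∧ v ∈ Y ∧ H.ConnectedOn ∅ Y ∧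
    ∃ T : Hypergraph α, T.IsLinearTree ∧ T.vertexSet = Y ∧ T.edgeSet ⊆ H.edgeSet ∧
      ∀ f ∈ H.edgeSet, f ∉ T.edgeSet → ∀ a ∈ f, ∀ b ∈ f, a ∈ Y → b ∈ Y → a = b}
  have hSfin : S.Finite := hfin.finite_subsets.subset fun Y hY => hY.1
  obtain ⟨Y, ⟨hYV, hvY, hYc, T, hT, rfl, hTH, hTm⟩, hmax⟩ := hSfin.exists_maximal
    ⟨{v}, by simpa using hv, rfl, connectedOn_singleton ∅ v, ⟨{v}, ∅, by simp⟩,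
      .isolatedVertex _ ⟨⟨v, rfl⟩, rfl⟩, rfl, empty_subset _, by simp; grind⟩
  by_cases hYeq : T.vertexSet = H.vertexSet
  · have hE : T.edgeSet = H.edgeSet := by
      refine hTH.antisymm fun f hf => ?_
      by_contra hfT
      obtain ⟨a, b, c, hab, -, -, habc⟩ := encard_eq_three.1 (hunif f hf)
      have hfV := H.subset_vertexSet_of_mem_edgeSet' hf
      exact hab (hTm f hf hfT a (by grind) b (by grind) (by grind) (by grind))
    exact htree ((Hypergraph.ext hYeq hE : T = H) ▸ hT)
  obtain ⟨z, hz, hzY⟩ : (H.vertexSet \ T.vertexSet).Nonempty := by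
    rw [nonempty_iff_ne_empty, Ne, sdiff_eq_empty]
    exact fun h => hYeq (hYV.antisymm h)
  obtain ⟨e, he, -, hey, ⟨b, hbe, hbV, hbY⟩⟩ := hconn.connectedOn _ hYV ⟨v, hvY⟩ ⟨z, hz, hzY⟩
  have heT : e ∉ T.edgeSet := fun h => hbY (T.subset_vertexSet_of_mem_edgeSet' h hbe)
  have hsub : ∀ f ∈ H.edgeSet, f ⊆ H.vertexSet := H.subset_vertexSet_of_mem_edgeSet'
  have hY'c := hYc.union_edge he hey
  rw [sdiff_empty] at hY'c
  have hY'V : T.vertexSet ∪ e ⊆ H.vertexSet := union_subset hYV (hsub e he)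
  obtain ⟨w, hwe, hwY⟩ := hey
  have heY : e ∩ T.vertexSet = {w} := by
    ext x
    refine ⟨fun hx => hTm e he heT x hx.1 w hwe hx.2 hwY, ?_⟩
    rintro rfl
    exact ⟨hwe, hwY⟩
  refine hbY (hmax (y := T.vertexSet ∪ e) ⟨hY'V, .inl hvY, hY'c,
    ⟨T.vertexSet ∪ e, insert e T.edgeSet, ?_⟩, .addEdge T _ e hT (by simp [heY]) rfl rfl, rfl,
    insert_subset he hTH, ?_⟩ subset_union_left (.inr hbe))
  · rintro f (rfl | hf)
    · exact subset_union_right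
    · exact (T.subset_vertexSet_of_mem_edgeSet' hf).trans subset_union_left
  intro f hf hfT a ha b hb haY hbY'
  by_contra hab
  have hfe : f ≠ e := by rintro rfl; exact hfT (mem_insert _ _)
  have hfT' : f ∉ T.edgeSet := fun h => hfT (.inr h)
  have hff := hunif.finite_of_mem hf
  -- `f` has at most one vertex in `T` and at most one in `e`, so it adds exactly one vertex to the
  -- union: one of the two sizes is even.
  have hint : (T.vertexSet ∪ e) ∩ f = {a, b} := by
    ext x
    have h₁ := hTm f hf hfT'
    have h₂ := fun p q => @IsLinear.eq_of_mem _ _ hlin f e hf he hfe p q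
    simp only [mem_inter_iff, mem_union, mem_insert_iff, mem_singleton_iff]
    grind
  have hY''c := hY'c.union_edge hf ⟨a, ha, haY⟩
  rw [sdiff_empty] at hY''c
  have hsum := ncard_union_add_ncard_inter (T.vertexSet ∪ e) f (hfin.subset hY'V) hff
  rw [hint, ncard_pair hab, hunif.ncard_eq hf] at hsum
  have h₁ := hno _ hY'V (.inl hvY) hY'c
  have h₂ := hno _ (union_subset hY'V (hsub f hf)) (.inl (.inl hvY)) hY''c
  grind

lemma isLinearTree_of_avoiderWinsAsFirst (hfin : H.vertexSet.Finite)
    (hodd : Odd H.vertexSet.ncard) (hconn : H.IsConnected) (hlin : H.IsLinear)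
    (hunif : H.IsUniform 3) (hwin : H.AvoiderWinsAsFirst) : H.IsLinearTree := by
  by_contra htree
  unfold AvoiderWinsAsFirst at hwin
  generalize hU : H.vertexSet = U at hwin
  generalize hA : (∅ : Set α) = A at hwin
  cases hwin with
  | gameOver => simp [hU] at hodd
  | avoiderMove _ _ v hv h =>
    subst hU hA
    obtain ⟨Y, hYV, hvY, hYc, hev⟩ := exists_even_connectedOn hfin hconn hlin hunif htree hv
    obtain ⟨Z, hZ, hZt⟩ := hYc.exists_isTrap (hfin.subset hYV) (by simp) hvY hev
    have hcard := ncard_sdiff_singleton_add_one hv hfin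
    refine hZt.not_avoiderWinsFrom_enforcer (fun U' hU' hc hZU' => ?_)
      (hfin.subset sdiff_subset) (by grind) (hZ.trans (sdiff_subset_sdiff_left hYV)) h
    obtain ⟨n, hn⟩ := hodd
    -- After one move each, `2 * n - 1 = 2 * (n - 1) + 1` vertices are free; `hc` forces `n ≥ 1`.
    exact hZt.not_avoiderWinsFrom_avoider hlin hunif (n := n - 1)
      (hfin.subset (hU'.trans sdiff_subset)) (by omega) hZU'

/-! ### Avoider's pairing strategy -/

/-- If the free vertices are paired by `σ` and every edge either contains a pair or has already been
hit by Enforcer, then Avoider wins as second player. -/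
lemma avoiderWinsFrom_of_pairing (σ : α → α) {n : ℕ} {A U : Set α} (hfin : U.Finite)
    (hcard : U.ncard ≤ n) (hA : Disjoint A U)
    (hσ : ∀ x ∈ U, σ x ∈ U ∧ σ x ≠ x ∧ σ (σ x) = x)
    (hE : ∀ e ∈ H.edgeSet, ¬ e ⊆ A ∪ U ∨ ∃ x ∈ U, x ∈ e ∧ σ x ∈ e) :
    H.AvoiderWinsFrom .enforcer A U := by
  induction n generalizing A U with
  | zero =>
    obtain rfl : U = ∅ := by rwa [Nat.le_zero, ncard_eq_zero hfin] at hcard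
    exact .gameOver _ _ (by simpa using hE)
  | succ n ih =>
    rcases U.eq_empty_or_nonempty with rfl | hne
    · exact .gameOver _ _ (by simpa using hE)
    refine .enforcerMove _ _ hne fun y hy => ?_
    obtain ⟨h₁, h₂, h₃⟩ := hσ y hy
    refine .avoiderMove _ _ (σ y) ⟨h₁, h₂⟩ (ih ?_ ?_ ?_ ?_ ?_)
    · exact (hfin.subset sdiff_subset).subset sdiff_subset
    · have := ncard_sdiff_singleton_add_one hy hfin
      have := ncard_le_ncard (sdiff_subset (s := U \ {y}) (t := {σ y}))
        (hfin.subset sdiff_subset)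
      omega
    · rw [disjoint_left] at hA ⊢
      grind
    · intro x hx
      have := hσ x (by grind)
      grind
    · intro e he
      have hyA : y ∉ A := fun h => disjoint_left.1 hA h hy
      obtain h | ⟨x, hx, hxe, hσx⟩ := hE e he
      · exact .inl fun h' => h (by grind)
      · have := hσ x hx
        by_cases hxy : x = y ∨ x = σ y
        -- The pair in `e` is `{y, σ y}`, so Enforcer's pick `y` has spoiled `e`.
        · exact .inl fun h' => by grind
        · exact .inr ⟨x, by grind⟩

/-- All vertices but one of a `3`-uniform linear tree can be paired so that each edge contains a
pair. -/
lemma IsLinearTree.exists_pairing (hT : H.IsLinearTree) (hunif : H.IsUniform 3) :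
    ∃ v ∈ H.vertexSet, ∃ σ : α → α,
      (∀ x ∈ H.vertexSet \ {v}, σ x ∈ H.vertexSet \ {v} ∧ σ x ≠ x ∧ σ (σ x) = x) ∧
      ∀ e ∈ H.edgeSet, ∃ x ∈ H.vertexSet \ {v}, x ∈ e ∧ σ x ∈ e := by
  classical
  induction hT with
  | isolatedVertex H hH =>
    obtain ⟨⟨v, hv⟩, hE⟩ := hH
    exact ⟨v, by simp [hv], id, by simp [hv], by simp [hE]⟩
  | addEdge T H e hT he hV hE ih =>
    obtain ⟨v, hv, σ, hσ, hσE⟩ := ih fun f hf => hunif f (by simp [hE, hf])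
    have h₃ := encard_sdiff_add_encard_inter e T.vertexSet
    rw [he, hunif e (by simp [hE])] at h₃
    have h₂ : (e \ T.vertexSet).encard = 2 := by
      generalize (e \ T.vertexSet).encard = k at h₃
      enat_to_nat
      omega
    obtain ⟨a, b, hab, heab⟩ := encard_eq_two.1 h₂
    have ha : a ∈ e \ T.vertexSet := by simp [heab]
    have hb : b ∈ e \ T.vertexSet := by simp [heab]
    refine ⟨v, by simp [hV, hv], fun x => if x = a then b else if x = b then a else σ x, ?_, ?_⟩
    · intro x hx
      have hx' : x ∈ T.vertexSet ∨ x = a ∨ x = b := by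
        by_cases hxT : x ∈ T.vertexSet
        · exact .inl hxT
        · have : x ∈ e \ T.vertexSet := by grind
          rw [heab] at this
          exact .inr this
      grind
    · intro f hf
      rw [hE] at hf
      rcases hf with rfl | hf
      · exact ⟨a, by grind⟩
      · obtain ⟨x, hx, hxf, hσx⟩ := hσE f hf
        exact ⟨x, by grind⟩

lemma IsLinearTree.avoiderWinsAsFirst (hT : H.IsLinearTree) (hunif : H.IsUniform 3)
    (hfin : H.vertexSet.Finite) : H.AvoiderWinsAsFirst := by
  obtain ⟨v, hv, σ, hσ, hσE⟩ := hT.exists_pairing hunif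
  exact .avoiderMove _ _ v hv (avoiderWinsFrom_of_pairing σ (hfin.subset sdiff_subset) le_rfl
    (by simp) hσ fun e he => .inr (hσE e he))

/-- The last edge added is a leaf-edge: its new vertices lie in no other edge. -/
lemma IsLinearTree.isIsolatedVertex (hT : H.IsLinearTree) (hunif : H.IsUniform 3)
    (hred : H.IsReduced) : H.IsIsolatedVertex := by
  cases hT with
  | isolatedVertex _ hH => exact hH
  | addEdge T _ e hT he hV hE =>
    have heH : e ∈ H.edgeSet := by simp [hE]
    refine absurd (hunif e heH) (hred e ⟨heH, ?_⟩)
    refine (encard_le_encard ?_).trans he.le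
    rintro x ⟨hxe, hdeg⟩
    refine ⟨hxe, ?_⟩
    by_contra hxT
    refine hdeg.not_ge (encard_le_one_iff.2 ?_)
    have key : ∀ f ∈ H.edgeSet, x ∈ f → f = e := by
      intro f hf hxf
      rw [hE] at hf
      exact hf.resolve_right fun h => hxT (T.subset_vertexSet_of_mem_edgeSet' h hxf)
    rintro f g ⟨hf, hxf⟩ ⟨hg, hxg⟩
    rw [key f hf hxf, key g hg hxg]

end Hypergraph

theorem mainTheorem6 {α : Type*} (H : Hypergraph α) (hfin : H.vertexSet.Finite)
    (hodd : Odd H.vertexSet.ncard) (hconn : H.IsConnected) (hlin : H.IsLinear)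
    (hunif : H.IsUniform 3) :
    (H.AvoiderWinsAsLast ↔ H.IsLinearTree) ∧
      (H.IsReduced → (H.AvoiderWinsAsLast ↔ H.IsIsolatedVertex)) := by
  have key : H.AvoiderWinsAsLast ↔ H.IsLinearTree :=
    ⟨fun h => Hypergraph.isLinearTree_of_avoiderWinsAsFirst hfin hodd hconn hlin hunif (h.1 hodd),
      fun h => ⟨fun _ => h.avoiderWinsAsFirst hunif hfin,
        fun h' => absurd hodd (Nat.not_odd_iff_even.2 h')⟩⟩
  exact ⟨key, fun hred => key.trans
    ⟨fun h => h.isIsolatedVertex hunif hred, fun h => .isolatedVertex H h⟩⟩
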